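/- Consider a market with a finite set $M$ of $m$ items and a set $N$ of $n\ge 1$ consumers, consumer $i$ having a valuation $v_i:2^M\to\mathbb{R}_{\ge 0}$; let $\mu=\min\{n,m\}$. The weighted rank function of a matroid $(M,\mathcal I)$ with item weights $w:M\to\mathbb{R}_{\ge 0}$ is $S\mapsto\max\{\sum_{j\in I}w(j) : I\subseteq S,\ I\in\mathcal I\}$. A \emph{competitive bundling equilibrium} consists of a partition $\mathcal B$ of $M$ into non-empty bundles, an allocation of pairwise disjoint sets of bundles $S_1,\dots,S_n\subseteq\mathcal B$ to the consumers, and a price $p_B\ge 0$ for every $B\in\mathcal B$, such that (1) for every consumer $i$ and every $T\subseteq\mathcal B$, $$v_i\Big(\bigcup_{B\in S_i}B\Big)-\sum_{B\in S_i}p_B\ \ge\ v_i\Big(\bigcup_{B\in T}B\Big)-\sum_{B\in T}p_B,$$ and (2) every item is allocated: $\bigcup_i\bigcup_{B\in S_i}B=M$. Its revenue is $\sum_i\sum_{B\in S_i}p_B$. The optimal welfare $\mathrm{OPT}$ is the maximum of $\sum_i v_i(O_i)$ over all families $(O_1,\dots,O_n)$ of pairwise disjoint subsets of $M$. There is a universal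 constant $c>0$ such that the following holds for all $n\ge 1$ and $m\ge 0$. Suppose that either 1. every $v_i$ is a weighted rank function of a uniform matroid on $M$ (the rank and the weights may depend on $i$), or 2. all $v_i$ are weighted rank functions of one common matroid on $M$ (the weights may depend on $i$). Then there is a competitive bundling equilibrium whose revenue is at least $\dfrac{c}{1+\log\mu}\cdot\mathrm{OPT}$, i.e. an $\Omega(1/\log\mu)$ fraction of the optimal welfare (for $m=0$ there are no items, both quantities are $0$, and $\log\mu$ is read as $0$). -/

import Mathlib

/-- The uniform matroid of rank `min k |α|` on the finite ground set `α`: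
a set is independent iff it has at most `k` elements. -/
def uniformMatroid (α : Type*) [Fintype α] (k : ℕ) : Matroid α :=
  (IndepMatroid.ofFinite (Set.finite_univ : (Set.univ : Set α).Finite)
    (fun I => I.ncard ≤ k)
    (by simp)
    (fun _ J hJ hIJ => (Set.ncard_le_ncard hIJ (Set.toFinite J)).trans hJ)
    (fun I J _ hJ hIJ => by
      obtain ⟨e, heJ, heI⟩ := Set.exists_mem_notMem_of_ncard_lt_ncard hIJ (Set.toFinite I)
      refine ⟨e, heJ, heI, ?_⟩
      rw [Set.ncard_insert_of_notMem heI (Set.toFinite I)]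
      omega)
    (fun _ _ => Set.subset_univ _)).matroid

/-- `v` is the weighted rank function of the matroid `Q` (whose ground set is the set of all items)
with non-negative item weights `w`: `v S` is the maximum total weight of an independent
subset of `S`. -/
def IsWeightedRankFunction {α : Type*} (Q : Matroid α) (w : α → ℝ) (v : Finset α → ℝ) : Prop :=
  Q.E = Set.univ ∧ (∀ j, 0 ≤ w j) ∧
    ∀ S : Finset α,
      IsGreatest {x : ℝ | ∃ I : Finset α, I ⊆ S ∧ Q.Indep (I : Set α) ∧ x = ∑ j ∈ I, w j} (v S)

/-- All valuations are weighted rank functions of uniform matroids; rank and weights may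
depend on the consumer. -/
def AllUniformRank {ι α : Type*} [Fintype α] (v : ι → Finset α → ℝ) : Prop :=
  ∀ i, ∃ (k : ℕ) (w : α → ℝ), IsWeightedRankFunction (uniformMatroid α k) w (v i)

/-- All valuations are weighted rank functions of one common matroid; the weights may
depend on the consumer. -/
def AllCommonMatroidRank {ι α : Type*} (v : ι → Finset α → ℝ) : Prop :=
  ∃ Q : Matroid α, ∀ i, ∃ w : α → ℝ, IsWeightedRankFunction Q w (v i)

/-- The optimal welfare: the maximum of `∑ i, v i (O i)` over all allocations of (some of) the
items, i.e. over all families `O` of pairwise disjoint item sets. -/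
noncomputable def optimalWelfare {ι α : Type*} [Fintype ι] (v : ι → Finset α → ℝ) : ℝ :=
  ⨆ O : {O : ι → Finset α // Pairwise fun i k => Disjoint (O i) (O k)}, ∑ i, v i (O.1 i)

/-- A competitive bundling equilibrium of the market with items `α`, consumers `ι` and
valuations `v`. For a set `T` of bundles, `T.sup id` is the union of the bundles in `T`. -/
structure CompetitiveBundlingEquilibrium {ι α : Type*} [Fintype ι] [Fintype α] [DecidableEq α]
    (v : ι → Finset α → ℝ) where
  /-- the partition of the items into bundles -/
  bundling : Finpartition (Finset.univ : Finset α)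
  /-- the set of bundles that each consumer receives -/
  alloc : ι → Finset (Finset α)
  /-- the bundle prices (only the values at bundles of the bundling are relevant) -/
  price : Finset α → ℝ
  alloc_subset : ∀ i, alloc i ⊆ bundling.parts
  alloc_disjoint : Pairwise fun i k => Disjoint (alloc i) (alloc k)
  price_nonneg : ∀ B ∈ bundling.parts, 0 ≤ price B
  profit_maximization : ∀ i, ∀ T ⊆ bundling.parts,
    v i (T.sup id) - ∑ B ∈ T, price B ≤ v i ((alloc i).sup id) - ∑ B ∈ alloc i, price B
  market_clearance : (Finset.univ.sup fun i => (alloc i).sup id) = (Finset.univ : Finset α)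

/-- The revenue of an equilibrium: the total payment of the consumers. -/
def CompetitiveBundlingEquilibrium.revenue {ι α : Type*} [Fintype ι] [Fintype α] [DecidableEq α]
    {v : ι → Finset α → ℝ} (E : CompetitiveBundlingEquilibrium v) : ℝ :=
  ∑ i, ∑ B ∈ E.alloc i, E.price B

/-! Only one fact about the valuations matters: each is a weighted rank function of some matroid,
which may vary with the consumer.

Take a Walrasian equilibrium with prices `p` and utilities `u i`. By weak duality, OPT is at most
the total price plus the total utility. Suppose every bundling equilibrium has revenue below `B`.
The Walrasian equilibrium itself yields one, so the total price is below `B`. For `ρ > 0`, keep only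
the set `K` of consumers with utility at least `ρ`. A descending auction from `p`
(`exists_walrasian_le`) resells the items to `K` at lower prices, so utilities in `K` stay at least
`ρ`. Now merge each consumer's items into one bundle and add `ρ` to its price. Consumers in `K`
remain satisfied, since any other purchase carries a surcharge too. Consumers outside `K` may merge
and buy bundles by overbidding slightly (`IsMergingState.take`), which never lowers the total price.
The limit is an equilibrium with revenue at least `ρ * K.card` (`exists_equilibrium_of_walrasian`),
so at most `B / ρ` consumers have utility at least `ρ`. At most `μ` utilities are positive, so they
sum to at most `B` times the harmonic number of `μ`, and OPT is less than `2 * B * (1 + log μ)`. -/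

/-! ### Exchange and maximum-weight independent sets -/

section MaxWeightIndep

variable {α : Type*}

/-- Simultaneous exchange between two independent sets of a matroid. -/
theorem Matroid.Indep.simultaneous_exchange [DecidableEq α] {Q : Matroid α} {I J : Finset α}
    (hI : Q.Indep (I : Set α)) (hJ : Q.Indep (J : Set α)) {a : α} (haI : a ∈ I) (haJ : a ∉ J) :
    Q.Indep (insert a J : Finset α) ∨
      ∃ b ∈ J, b ∉ I ∧ Q.Indep (insert b (I.erase a) : Finset α) ∧
        Q.Indep (insert a (J.erase b) : Finset α) := by
  by_cases hins : Q.Indep (insert a J : Finset α)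
  · exact Or.inl hins
  right
  have haE : a ∈ Q.E := hI.subset_ground (by simpa using haI)
  have haJ' : a ∉ (J : Set α) := by simpa using haJ
  have hacl : a ∈ Q.closure J := by
    by_contra hcon
    rw [hJ.notMem_closure_iff_of_notMem haJ' haE] at hcon
    exact hins (by simpa using hcon)
  have hC := hJ.fundCircuit_isCircuit hacl haJ'
  -- If no exchange works, every element of the fundamental circuit of `a` in `J` other than `a` is
  -- spanned by `I \ {a}`: it lies there, or adding it destroys independence. Hence `I \ {a}` spans
  -- `a`, contradicting independence of `I`.
  by_contra! hcon
  have hIa : Q.Indep ((I : Set α) \ {a}) := hI.subset Set.sdiff_subset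
  have hsub : Q.fundCircuit a J \ {a} ⊆ Q.closure ((I : Set α) \ {a}) := by
    rintro b ⟨hbC, hba⟩
    have hbJ : b ∈ J := by
      have := Q.fundCircuit_subset_insert a J hbC
      simpa [show b ≠ a from hba] using this
    have hbE : b ∈ Q.E := hJ.subset_ground (by simpa using hbJ)
    by_cases hbI : b ∈ I
    · exact Q.mem_closure_of_mem' ⟨by simpa using hbI, hba⟩ hbE
    · by_contra hbcl
      rw [hIa.notMem_closure_iff hbE] at hbcl
      refine hcon b hbJ hbI ?_ ?_
      · simpa using hbcl.1
      · have := (hJ.mem_fundCircuit_iff hacl haJ').1 hbC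
        convert this using 1
        ext x
        by_cases hxa : x = a <;> by_cases hxb : x = b <;> simp_all
  have ha : a ∈ Q.closure (Q.fundCircuit a J \ {a}) :=
    hC.mem_closure_sdiff_singleton_of_mem (Q.mem_fundCircuit a J)
  have hmem : a ∈ Q.closure ((I : Set α) \ {a}) :=
    (Q.closure_subset_closure_of_subset_closure hsub) ha
  exact (hI.notMem_closure_sdiff_of_mem (by simpa using haI)) hmem

/-- `D` is an independent set of maximum total weight. -/
def Matroid.IsMaxWeightIndep (Q : Matroid α) (c : α → ℝ) (D : Finset α) : Prop :=
  Q.Indep (D : Set α) ∧ ∀ I : Finset α, Q.Indep (I : Set α) → ∑ e ∈ I, c e ≤ ∑ e ∈ D, c e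

theorem Matroid.exists_isMaxWeightIndep [Fintype α] (Q : Matroid α) (c : α → ℝ) :
    ∃ D, Q.IsMaxWeightIndep c D := by
  obtain ⟨D, hD, hmax⟩ := Set.exists_max_image {D : Finset α | Q.Indep (D : Set α)}
    (fun D => ∑ e ∈ D, c e) (Set.toFinite _) ⟨∅, by simp⟩
  exact ⟨D, hD, hmax⟩

theorem Matroid.IsMaxWeightIndep.of_le {Q : Matroid α} {c c' : α → ℝ} {D : Finset α}
    (h : Q.IsMaxWeightIndep c D) (hle : ∀ e, c' e ≤ c e) (heq : ∀ e ∈ D, c' e = c e) :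
    Q.IsMaxWeightIndep c' D :=
  ⟨h.1, fun I hI => (Finset.sum_le_sum fun e _ => hle e).trans
    ((h.2 I hI).trans_eq (Finset.sum_congr rfl fun e he => (heq e he).symm))⟩

/-- If the weight of a single element `x` is raised, a maximum-weight independent set can be found
inside `insert x D`, where `D` is a maximum-weight independent set for the old weights. -/
theorem Matroid.IsMaxWeightIndep.exists_subset_insert [Fintype α] [DecidableEq α] {Q : Matroid α}
    {c c' : α → ℝ} {D : Finset α} (h : Q.IsMaxWeightIndep c D) {x : α} (hle : ∀ e, c e ≤ c' e)
    (heq : ∀ e, e ≠ x → c' e = c e) :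
    ∃ D' ⊆ insert x D, Q.IsMaxWeightIndep c' D' := by
  -- Minimize the number of elements outside `insert x D`. If such a `b` remains, exchange it with
  -- `D`: optimality of `D` gives `c b ≤ 0`, or `c b ≤ c a ≤ c' a` for some `a ∈ D`. Dropping `b`,
  -- or replacing it by `a`, then loses no weight and contradicts minimality.
  obtain ⟨D', hD', hmin⟩ := Set.exists_min_image {D' : Finset α | Q.IsMaxWeightIndep c' D'}
    (fun D' => (D' \ insert x D).card) (Set.toFinite _) (Q.exists_isMaxWeightIndep c')
  refine ⟨D', ?_, hD'⟩
  by_contra hsub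
  obtain ⟨b, hbD', hb⟩ := Finset.not_subset.1 hsub
  have hbx : b ≠ x := fun hh => hb (by simp [hh])
  have hbD : b ∉ D := fun hh => hb (by simp [hh])
  have key : ∀ D'' : Finset α, D'' \ insert x D ⊆ (D' \ insert x D).erase b →
      Q.Indep (D'' : Set α) → ∑ e ∈ D', c' e ≤ ∑ e ∈ D'', c' e → False := by
    intro D'' hsub'' hind hsum
    have h1 := hmin D'' ⟨hind, fun I hI => (hD'.2 I hI).trans hsum⟩
    have h2 := Finset.card_le_card hsub''
    have h3 := Finset.card_erase_lt_of_mem (Finset.mem_sdiff.2 ⟨hbD', hb⟩)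
    omega
  rcases hD'.1.simultaneous_exchange h.1 hbD' hbD with hins | ⟨a, haD, haD', h1, h2⟩
  · refine key (D'.erase b) (by intro y; simp; tauto)
      (hD'.1.subset (by simp)) ?_
    have := h.2 _ hins
    rw [Finset.sum_insert hbD] at this
    rw [← Finset.add_sum_erase _ _ hbD', heq b hbx]
    linarith
  · refine key (insert a (D'.erase b)) ?_ h1 ?_
    · intro y
      simp only [Finset.mem_sdiff, Finset.mem_insert, Finset.mem_erase]
      rintro ⟨rfl | hy, hy'⟩
      · exact absurd (Or.inr haD) hy'
      · exact ⟨hy.1, hy.2, hy'⟩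
    · have := h.2 _ h2
      rw [Finset.sum_insert (by simp [hbD]), ← Finset.add_sum_erase _ _ haD] at this
      rw [← Finset.add_sum_erase _ _ hbD', Finset.sum_insert (by simp [haD']), heq b hbx]
      linarith [hle a]

end MaxWeightIndep

/-! ### Passing to the limit in approximate auctions -/

/-- A compactness principle: conditions that can be satisfied approximately to any precision, by
one of finitely many discrete choices and a point of a compact set, can be satisfied by one choice
and one point to all precisions. -/
theorem IsCompact.exists_forall_pos {D Y : Type*} [Finite D] [TopologicalSpace Y] [T2Space Y]
    {C : Set Y} (hC : IsCompact C) (R : D → ℝ → Y → Prop)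
    (hclosed : ∀ d ε, IsClosed {p | R d ε p})
    (hmono : ∀ d p ε ε', ε ≤ ε' → R d ε p → R d ε' p)
    (h : ∀ ε > 0, ∃ d, ∃ p ∈ C, R d ε p) : ∃ d, ∃ p ∈ C, ∀ ε > 0, R d ε p := by
  have h' : ∀ n : ℕ, ∃ d, ∃ p ∈ C, R d (1 / ((n : ℝ) + 1)) p := fun n => h _ (by positivity)
  choose d p hpC hp using h'
  -- One choice recurs infinitely often. Its later points also meet the coarser conditions, so
  -- Cantor's intersection theorem applies.
  obtain ⟨d₀, hd₀⟩ := Finite.exists_infinite_fiber d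
  have hanti : ∀ {n k : ℕ}, n ≤ k → 1 / ((k : ℝ) + 1) ≤ 1 / ((n : ℝ) + 1) :=
    fun hnk => Nat.one_div_le_one_div hnk
  have hclosed' : ∀ n : ℕ, IsClosed {q | R d₀ (1 / ((n : ℝ) + 1)) q} := fun n => hclosed _ _
  obtain ⟨q, hq⟩ := IsCompact.nonempty_iInter_of_sequence_nonempty_isCompact_isClosed
    (fun n : ℕ => C ∩ {q | R d₀ (1 / ((n : ℝ) + 1)) q})
    (fun n q hq => ⟨hq.1, hmono _ _ _ _ (hanti n.le_succ) hq.2⟩)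
    (fun n => by
      obtain ⟨k, hk, hnk⟩ := (Set.infinite_coe_iff.1 hd₀).exists_gt n
      refine ⟨p k, hpC k, hmono _ _ _ _ (hanti hnk.le) ?_⟩
      have : d k = d₀ := hk
      exact this ▸ hp k)
    (hC.inter_right (hclosed' 0))
    (fun n => hC.isClosed.inter (hclosed' n))
  rw [Set.mem_iInter] at hq
  refine ⟨d₀, q, (hq 0).1, fun ε hε => ?_⟩
  obtain ⟨n, hn⟩ := exists_nat_one_div_lt hε
  exact hmono _ _ _ _ hn.le (hq n).2

/-! ### Walrasian equilibria below given prices -/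

section DescendingAuction

variable {ι α : Type*} [Fintype ι] [Fintype α] [DecidableEq α]

/-- State of a descending auction with step `ε` that starts at the prices `p₀`: every consumer
holds an optimal set when the items of other consumers are charged `ε` more than their price. -/
structure IsDescendingState (Q : ι → Matroid α) (w : ι → α → ℝ) (p₀ : α → ℝ) (ε : ℝ)
    (A : ι → Finset α) (p : α → ℝ) : Prop where
  disjoint : Pairwise fun i k => Disjoint (A i) (A k)
  nonneg : ∀ e, 0 ≤ p e
  le_start : ∀ e, p e ≤ p₀ e
  optimal : ∀ i, (Q i).IsMaxWeightIndep (fun e => w i e - p e - if e ∈ A i then 0 else ε) (A i)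

/-- The final state of a descending auction: unsold items are cheap. -/
theorem exists_descendingState_unsold_le (Q : ι → Matroid α) (w : ι → α → ℝ) {p₀ : α → ℝ}
    {S : ι → Finset α} (hp₀ : ∀ e, 0 ≤ p₀ e) (hS : Pairwise fun i k => Disjoint (S i) (S k))
    (hopt : ∀ i, (Q i).IsMaxWeightIndep (fun e => w i e - p₀ e) (S i)) {ε : ℝ} (hε : 0 < ε) :
    ∃ A p, IsDescendingState Q w p₀ ε A p ∧ ∀ e, (∀ i, e ∉ A i) → p e ≤ ε := by
  classical
  let X : Set ℝ := {x | ∃ A p, IsDescendingState Q w p₀ ε A p ∧ x = ∑ e, p e}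
  have hXne : X.Nonempty := by
    refine ⟨_, S, p₀, ⟨hS, hp₀, fun _ => le_rfl, fun i => (hopt i).of_le ?_ ?_⟩, rfl⟩
    · intro e
      split_ifs <;> linarith
    · intro e he
      simp [he]
  have hXbdd : BddBelow X := by
    refine ⟨0, ?_⟩
    rintro x ⟨A, p, h, rfl⟩
    exact Finset.sum_nonneg fun e _ => h.nonneg e
  -- The auction's end is found by extremality: the total price is within `ε` of the infimum, so no
  -- state has one price lowered by `ε`. At these prices, the allocation then maximizes total
  -- utility.
  obtain ⟨x, ⟨A₁, p, hA₁, rfl⟩, hx⟩ :=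
    exists_lt_of_csInf_lt hXne (lt_add_of_pos_right (sInf X) hε)
  obtain ⟨A, hA, hmax⟩ := Set.exists_max_image {A | IsDescendingState Q w p₀ ε A p}
    (fun A => ∑ i, ∑ e ∈ A i, (w i e - p e)) (Set.toFinite _) ⟨A₁, hA₁⟩
  have hA : IsDescendingState Q w p₀ ε A p := hA
  refine ⟨A, p, hA, fun e he => ?_⟩
  by_contra! hpe
  -- If waiving the `ε` charge on the unsold item `e` tempts nobody, its price can drop by `ε`.
  -- Otherwise some consumer strictly gains with a set inside `insert e (A i)`; this takes nothing
  -- from others and raises total utility.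
  by_cases H : ∀ i, (Q i).IsMaxWeightIndep
      (fun x => w i x - p x - if x ∈ A i ∨ x = e then 0 else ε) (A i)
  · have hstate : IsDescendingState Q w p₀ ε A (Function.update p e (p e - ε)) := by
      refine ⟨hA.disjoint, fun x => ?_, fun x => ?_, fun i => ?_⟩
      · rcases eq_or_ne x e with rfl | hxe
        · simp [hpe.le]
        · simp [hxe, hA.nonneg x]
      · rcases eq_or_ne x e with rfl | hxe
        · simpa using (by linarith [hA.le_start x] : p x - ε ≤ p₀ x)
        · simp [hxe, hA.le_start x]
      · convert H i using 2 with x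
        rcases eq_or_ne x e with rfl | hxe
        · simp [he i]
          ring
        · simp [hxe]
    have hle := csInf_le hXbdd ⟨A, _, hstate, rfl⟩
    rw [Finset.sum_update_of_mem (Finset.mem_univ e)] at hle
    rw [← Finset.add_sum_erase _ _ (Finset.mem_univ e)] at hx
    rw [← Finset.erase_eq] at hle
    linarith
  · obtain ⟨i, hi⟩ := not_forall.1 H
    obtain ⟨D, hDsub, hD⟩ := (hA.optimal i).exists_subset_insert (x := e)
      (c' := fun x => w i x - p x - if x ∈ A i ∨ x = e then 0 else ε)
      (fun x => by
        by_cases h1 : x ∈ A i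
        · simp [h1]
        · simp only [h1, false_or, if_false]
          split_ifs <;> linarith)
      (fun x hx => by simp [hx])
    have hDval : ∑ x ∈ D, (w i x - p x - if x ∈ A i ∨ x = e then 0 else ε)
        = ∑ x ∈ D, (w i x - p x) := by
      refine Finset.sum_congr rfl fun x hx => ?_
      have : x ∈ A i ∨ x = e := by simpa [or_comm] using hDsub hx
      simp [this]
    have hAval : ∑ x ∈ A i, (w i x - p x - if x ∈ A i ∨ x = e then 0 else ε)
        = ∑ x ∈ A i, (w i x - p x) :=
      Finset.sum_congr rfl fun x hx => by simp [hx]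
    have hlt : ∑ x ∈ A i, (w i x - p x) < ∑ x ∈ D, (w i x - p x) := by
      by_contra! hge
      refine hi ⟨(hA.optimal i).1, fun I hI => (hD.2 I hI).trans ?_⟩
      rw [hDval, hAval]
      exact hge
    have hstate : IsDescendingState Q w p₀ ε (Function.update A i D) p := by
      have hdisj : ∀ k, k ≠ i → Disjoint D (A k) := fun k hk => by
        refine Finset.disjoint_of_subset_left hDsub ?_
        rw [Finset.disjoint_insert_left]
        exact ⟨he k, hA.disjoint hk.symm⟩
      refine ⟨fun j k hjk => ?_, hA.nonneg, hA.le_start, fun j => ?_⟩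
      · rcases eq_or_ne j i with rfl | hj
        · simpa [hjk.symm] using hdisj k hjk.symm
        · rcases eq_or_ne k i with rfl | hk
          · simpa [hj] using (hdisj j hj).symm
          · simpa [hj, hk] using hA.disjoint hjk
      · rcases eq_or_ne j i with rfl | hj
        · simp only [Function.update_self]
          refine hD.of_le (fun x => ?_) (fun x hx => ?_)
          · by_cases hxD : x ∈ D
            · have : x ∈ A j ∨ x = e := by simpa [or_comm] using hDsub hxD
              simp [this, hxD]
            · simp only [hxD, if_false]
              split_ifs <;> linarith
          · have : x ∈ A j ∨ x = e := by simpa [or_comm] using hDsub hx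
            simp [this, hx]
        · simpa [hj] using hA.optimal j
    have hle := hmax _ hstate
    refine absurd hle (not_le.2 (Finset.sum_lt_sum (fun j _ => ?_) ⟨i, Finset.mem_univ i, ?_⟩))
    · rcases eq_or_ne j i with rfl | hj
      · simpa using hlt.le
      · simp [hj]
    · simpa using hlt

/-- Starting from prices at which all consumers hold optimal sets, with some items possibly unsold,
there is a Walrasian equilibrium with lower prices. -/
theorem exists_walrasian_le (Q : ι → Matroid α) (w : ι → α → ℝ) {p₀ : α → ℝ}
    {S : ι → Finset α} (hp₀ : ∀ e, 0 ≤ p₀ e) (hS : Pairwise fun i k => Disjoint (S i) (S k))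
    (hopt : ∀ i, (Q i).IsMaxWeightIndep (fun e => w i e - p₀ e) (S i)) :
    ∃ (A : ι → Finset α) (p : α → ℝ), (Pairwise fun i k => Disjoint (A i) (A k)) ∧
      (∀ e, 0 ≤ p e) ∧ (∀ e, p e ≤ p₀ e) ∧
      (∀ i, (Q i).IsMaxWeightIndep (fun e => w i e - p e) (A i)) ∧
      ∀ e, (∀ i, e ∉ A i) → p e = 0 := by
  classical
  let D := {A : ι → Finset α // (Pairwise fun i k => Disjoint (A i) (A k)) ∧
    ∀ i, (Q i).Indep (A i : Set α)}
  -- Charging `ε` on all items of `I`, even those in `A i`, weakens the optimality condition but has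
  -- the same limit as `ε` tends to 0.
  let R : D → ℝ → (α → ℝ) → Prop := fun A ε p =>
    (∀ i, ∀ I : Finset α, (Q i).Indep (I : Set α) →
      ∑ e ∈ I, (w i e - p e - ε) ≤ ∑ e ∈ A.1 i, (w i e - p e)) ∧
    ∀ e, (∀ i, e ∉ A.1 i) → p e ≤ ε
  have hclosed : ∀ A ε, IsClosed {p | R A ε p} := by
    intro A ε
    simp only [R, Set.ofPred_and, Set.ofPred_forall]
    refine IsClosed.inter ?_ ?_
    · exact isClosed_iInter fun i => isClosed_iInter fun I => isClosed_iInter fun _ =>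
        isClosed_le (by fun_prop) (by fun_prop)
    · exact isClosed_iInter fun e => isClosed_iInter fun _ => isClosed_le (by fun_prop) (by fun_prop)
  have hmono : ∀ A p ε ε', ε ≤ ε' → R A ε p → R A ε' p := by
    rintro A p ε ε' hle ⟨h1, h2⟩
    exact ⟨fun i I hI => le_trans (Finset.sum_le_sum fun e _ => by linarith) (h1 i I hI),
      fun e he => (h2 e he).trans hle⟩
  have hex : ∀ ε > 0, ∃ A, ∃ p ∈ Set.Icc 0 p₀, R A ε p := by
    intro ε hε
    obtain ⟨A, p, hA, hle⟩ := exists_descendingState_unsold_le Q w hp₀ hS hopt hε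
    refine ⟨⟨A, hA.disjoint, fun i => (hA.optimal i).1⟩, p, ⟨hA.nonneg, hA.le_start⟩,
      fun i I hI => ?_, hle⟩
    have h1 : ∑ e ∈ A i, (w i e - p e) = ∑ e ∈ A i, (w i e - p e - if e ∈ A i then 0 else ε) :=
      Finset.sum_congr rfl fun e he => by simp [he]
    show _ ≤ ∑ e ∈ A i, (w i e - p e)
    rw [h1]
    refine le_trans (Finset.sum_le_sum fun e _ => ?_) ((hA.optimal i).2 I hI)
    split_ifs <;> linarith
  obtain ⟨A, p, hpC, hR⟩ := isCompact_Icc.exists_forall_pos R hclosed hmono hex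
  refine ⟨A.1, p, A.2.1, hpC.1, hpC.2, fun i => ⟨A.2.2 i, fun I hI => ?_⟩, fun e he => ?_⟩
  · have hlim : Filter.Tendsto (fun ε : ℝ => ∑ e ∈ I, (w i e - p e - ε)) (nhdsWithin 0 (Set.Ioi 0))
        (nhds (∑ e ∈ I, (w i e - p e - 0))) :=
      ((continuous_finsetSum _ fun e _ => by fun_prop).tendsto' 0 _ rfl).mono_left
        nhdsWithin_le_nhds
    simp only [sub_zero] at hlim
    exact le_of_tendsto hlim (Filter.eventually_of_mem self_mem_nhdsWithin
      fun ε hε => (hR ε hε).1 i I hI)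
  · refine le_antisymm (le_of_forall_pos_le_add fun ε hε => ?_) (hpC.1 e)
    simpa using (hR ε hε).2 e he

end DescendingAuction

/-! ### Merging bundles until every consumer is satisfied -/

section MergingAuction

variable {ι α : Type*} [Fintype ι] [Fintype α] [DecidableEq α]

/-- State of an ascending auction in which bundles get merged: consumer `i` owns the bundle `A i`
(possibly empty) at price `r i`, all items are sold, and the consumers with non-empty bundles
are satisfied up to `ε`. -/
structure IsMergingState (v : ι → Finset α → ℝ) (ε : ℝ) (A : ι → Finset α) (r : ι → ℝ) :
    Prop where
  disjoint : Pairwise fun i k => Disjoint (A i) (A k)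
  cover : Finset.univ.biUnion A = Finset.univ
  nonneg : ∀ i, 0 ≤ r i
  price_eq_zero : ∀ i, A i = ∅ → r i = 0
  satisfied : ∀ i, A i ≠ ∅ → ∀ T : Finset ι,
    v i (T.biUnion A) - ∑ k ∈ T, r k ≤ v i (A i) - r i + ε

/-- An empty-handed consumer takes a favourite set of bundles and merges it, paying `ε` extra. -/
theorem IsMergingState.take {v : ι → Finset α → ℝ} {ε : ℝ} (hε : 0 ≤ ε) {A : ι → Finset α}
    {r : ι → ℝ} (h : IsMergingState v ε A r) {l : ι} (hl : A l = ∅) {T : Finset ι}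
    (hT : ∀ T' : Finset ι, v l (T'.biUnion A) - ∑ k ∈ T', r k ≤ v l (T.biUnion A) - ∑ k ∈ T, r k)
    (hne : T.biUnion A ≠ ∅) :
    ∃ A' r', IsMergingState v ε A' r' ∧ ∑ i, r' i = ∑ i, r i + ε := by
  classical
  have hrl : r l = 0 := h.price_eq_zero l hl
  -- Writing `r'` as a sum of two terms is harmless at `l`, where `r l = 0`, and makes sums over `U`
  -- split.
  let A' : ι → Finset α := fun j => if j = l then T.biUnion A else if j ∈ T then ∅ else A j
  let r' : ι → ℝ := fun j => (if j = l then ∑ k ∈ T, r k + ε else 0) + if j ∈ T then 0 else r j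
  have hsum : ∀ U : Finset ι, ∑ k ∈ U, r' k =
      (if l ∈ U then ∑ k ∈ T, r k + ε else 0) + ∑ k ∈ U \ T, r k := by
    intro U
    rw [Finset.sum_add_distrib, Finset.sum_ite_eq', ← Finset.filter_notMem_eq_sdiff,
      Finset.sum_filter]
    simp only [ite_not]
  have hA'l : A' l = T.biUnion A := by simp [A']
  have hr'l : r' l = ∑ k ∈ T, r k + ε := by simp [r', hrl]
  have hA'sub : ∀ j, j ≠ l → A' j ⊆ A j := fun j hj => by
    simp only [A', hj, if_false]
    split_ifs <;> simp
  have hA'T : ∀ j, j ≠ l → Disjoint (T.biUnion A) (A' j) := fun j hj => by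
    simp only [A', hj, if_false]
    split_ifs with hjT
    · simp
    · rw [Finset.disjoint_biUnion_left]
      exact fun k hk => h.disjoint fun hkj => hjT (hkj ▸ hk)
  have hmem : ∀ (U : Finset ι) (x : α), x ∈ U.biUnion A' ↔
      (l ∈ U ∧ x ∈ T.biUnion A) ∨ x ∈ (U \ T).biUnion A := by
    intro U x
    simp only [Finset.mem_biUnion, Finset.mem_sdiff]
    constructor
    · rintro ⟨k, hk, hx⟩
      by_cases hkl : k = l
      · subst hkl
        rw [hA'l, Finset.mem_biUnion] at hx
        exact Or.inl ⟨hk, hx⟩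
      · by_cases hkT : k ∈ T
        · simp [A', hkl, hkT] at hx
        · exact Or.inr ⟨k, ⟨hk, hkT⟩, hA'sub k hkl hx⟩
    · rintro (⟨hlU, hx⟩ | ⟨k, ⟨hk, hkT⟩, hx⟩)
      · exact ⟨l, hlU, by rwa [hA'l, Finset.mem_biUnion]⟩
      · refine ⟨k, hk, ?_⟩
        have hkl : k ≠ l := by
          rintro rfl
          simp [hl] at hx
        simpa [A', hkl, hkT] using hx
  -- Merging opens no better deal: whatever the new bundles offer was available before at no higher
  -- cost.
  have hold : ∀ U : Finset ι, ∃ U' : Finset ι, U.biUnion A' = U'.biUnion A ∧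
      ∑ k ∈ U', r k ≤ ∑ k ∈ U, r' k := by
    intro U
    by_cases hlU : l ∈ U
    · refine ⟨T ∪ U \ T, ?_, ?_⟩
      · ext x
        rw [hmem, Finset.union_biUnion, Finset.mem_union]
        simp [hlU]
      · rw [hsum, Finset.sum_union Finset.disjoint_sdiff, if_pos hlU]
        linarith
    · refine ⟨U \ T, ?_, ?_⟩
      · ext x
        rw [hmem]
        simp [hlU]
      · rw [hsum, if_neg hlU, zero_add]
  refine ⟨A', r', ⟨?_, ?_, ?_, ?_, ?_⟩, ?_⟩
  · intro j k hjk
    rcases eq_or_ne j l with rfl | hj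
    · rw [hA'l]
      exact hA'T k hjk.symm
    · rcases eq_or_ne k l with rfl | hk
      · rw [hA'l]
        exact (hA'T j hj).symm
      · exact Finset.disjoint_of_subset_left (hA'sub j hj)
          (Finset.disjoint_of_subset_right (hA'sub k hk) (h.disjoint hjk))
  · rw [Finset.eq_univ_iff_forall]
    intro x
    have hx : x ∈ Finset.univ.biUnion A := by simp [h.cover]
    obtain ⟨k, -, hk⟩ := Finset.mem_biUnion.1 hx
    rw [hmem]
    by_cases hkT : k ∈ T
    · exact Or.inl ⟨Finset.mem_univ _, Finset.mem_biUnion.2 ⟨k, hkT, hk⟩⟩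
    · exact Or.inr (Finset.mem_biUnion.2 ⟨k, by simp [hkT], hk⟩)
  · intro i
    have := Finset.sum_nonneg fun k (_ : k ∈ T) => h.nonneg k
    have := h.nonneg i
    simp only [r']
    split_ifs <;> linarith
  · intro i hi
    rcases eq_or_ne i l with rfl | hil
    · exact absurd (hA'l ▸ hi) hne
    · by_cases hiT : i ∈ T
      · simp [r', hil, hiT]
      · simp only [A', hil, hiT, if_false] at hi
        simp [r', hil, hiT, h.price_eq_zero i hi]
  · intro i hi U
    obtain ⟨U', hU', hle⟩ := hold U
    rw [hU']
    rcases eq_or_ne i l with rfl | hil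
    · rw [hA'l, hr'l]
      linarith [hT U']
    · have hiT : i ∉ T := fun hiT => hi (by simp [A', hil, hiT])
      have hAi : A' i = A i := by simp [A', hil, hiT]
      have hri : r' i = r i := by simp [r', hil, hiT]
      rw [hAi] at hi
      rw [hAi, hri]
      linarith [h.satisfied i hi U']
  · rw [hsum, if_pos (Finset.mem_univ l), ← Finset.sum_sdiff (Finset.subset_univ T) (f := r)]
    ring

/-- The final state of a merging auction with step `ε`: all consumers are satisfied up to `ε`, and
the total price has not decreased. -/
theorem IsMergingState.exists_satisfied {v : ι → Finset α → ℝ} (hv : ∀ i, v i ∅ = 0) {ε : ℝ}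
    (hε : 0 < ε) {A₀ : ι → Finset α} {r₀ : ι → ℝ} (h₀ : IsMergingState v 0 A₀ r₀) :
    ∃ A r, IsMergingState v ε A r ∧ ∑ i, r₀ i ≤ ∑ i, r i ∧
      ∀ i, ∀ T : Finset ι, v i (T.biUnion A) - ∑ k ∈ T, r k ≤ v i (A i) - r i + ε := by
  let X : Set ℝ := {x | ∃ A r, IsMergingState v ε A r ∧ ∑ i, r₀ i ≤ ∑ i, r i ∧ x = ∑ i, r i}
  have hXne : X.Nonempty := ⟨_, A₀, r₀, ⟨h₀.disjoint, h₀.cover, h₀.nonneg, h₀.price_eq_zero,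
    fun i hi T => by linarith [h₀.satisfied i hi T]⟩, le_rfl, rfl⟩
  have hXbdd : BddAbove X := by
    refine ⟨∑ i, (∑ S : Finset α, |v i S| + ε), ?_⟩
    rintro x ⟨A, r, h, -, rfl⟩
    refine Finset.sum_le_sum fun i _ => ?_
    have h1 : |v i (A i)| ≤ ∑ S : Finset α, |v i S| :=
      Finset.single_le_sum (f := fun S => |v i S|) (fun S _ => abs_nonneg _) (Finset.mem_univ _)
    by_cases hi : A i = ∅
    · rw [h.price_eq_zero i hi]
      linarith [abs_nonneg (v i (A i))]
    · have := h.satisfied i hi ∅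
      simp only [Finset.biUnion_empty, hv, Finset.sum_empty] at this
      linarith [le_abs_self (v i (A i))]
  -- The total price is within `ε` of its supremum, so one more `take` would exceed it.
  obtain ⟨x, ⟨A, r, h, hr, rfl⟩, hx⟩ := exists_lt_of_lt_csSup hXne (sub_lt_self (sSup X) hε)
  refine ⟨A, r, h, hr, fun l T => ?_⟩
  by_cases hl : A l = ∅
  · by_contra! hcon
    obtain ⟨T', -, hT'⟩ := Finset.exists_max_image Finset.univ
      (fun T : Finset ι => v l (T.biUnion A) - ∑ k ∈ T, r k) Finset.univ_nonempty
    have hTT' := hT' T (Finset.mem_univ _)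
    have hrl := h.price_eq_zero l hl
    have hne : T'.biUnion A ≠ ∅ := by
      intro hemp
      simp only [hemp, hv] at hTT'
      have := Finset.sum_nonneg fun k (_ : k ∈ T') => h.nonneg k
      rw [hl, hv, hrl] at hcon
      linarith
    obtain ⟨A', r', h', hsum⟩ := h.take hε.le hl (fun U => hT' U (Finset.mem_univ _)) hne
    have := le_csSup hXbdd ⟨A', r', h', by linarith, rfl⟩
    linarith
  · exact h.satisfied l hl T

/-- All consumers can be satisfied exactly, without decreasing the total price. -/
theorem IsMergingState.exists_exactly_satisfied {v : ι → Finset α → ℝ} (hv : ∀ i, v i ∅ = 0)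
    {A₀ : ι → Finset α} {r₀ : ι → ℝ} (h₀ : IsMergingState v 0 A₀ r₀) :
    ∃ A r, IsMergingState v 0 A r ∧ ∑ i, r₀ i ≤ ∑ i, r i ∧
      ∀ i, ∀ T : Finset ι, v i (T.biUnion A) - ∑ k ∈ T, r k ≤ v i (A i) - r i := by
  classical
  let D := {A : ι → Finset α // (Pairwise fun i k => Disjoint (A i) (A k)) ∧
    Finset.univ.biUnion A = Finset.univ}
  let R : D → ℝ → (ι → ℝ) → Prop := fun A ε r =>
    (∀ i, A.1 i = ∅ → r i = 0) ∧ ∑ i, r₀ i ≤ ∑ i, r i ∧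
    ∀ i, ∀ T : Finset ι, v i (T.biUnion A.1) - ∑ k ∈ T, r k ≤ v i (A.1 i) - r i + min ε 1
  have hclosed : ∀ A ε, IsClosed {r | R A ε r} := by
    intro A ε
    simp only [R, Set.ofPred_and, Set.ofPred_forall]
    refine IsClosed.inter ?_ (IsClosed.inter ?_ ?_)
    · exact isClosed_iInter fun i => isClosed_iInter fun _ => isClosed_eq (by fun_prop) (by fun_prop)
    · exact isClosed_le (by fun_prop) (by fun_prop)
    · exact isClosed_iInter fun i => isClosed_iInter fun T =>
        isClosed_le (by fun_prop) (by fun_prop)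
  have hmono : ∀ A r ε ε', ε ≤ ε' → R A ε r → R A ε' r := by
    rintro A r ε ε' hle ⟨h1, h2, h3⟩
    exact ⟨h1, h2, fun i T => (h3 i T).trans (by gcongr)⟩
  have hex : ∀ ε > 0, ∃ A, ∃ r ∈ Set.Icc (0 : ι → ℝ) (fun i => ∑ S : Finset α, |v i S| + 1),
      R A ε r := by
    intro ε hε
    -- Capping the step at 1 keeps the prices in a box independent of `ε`.
    obtain ⟨A, r, h, hr, hsat⟩ := h₀.exists_satisfied hv (lt_min hε one_pos)
    refine ⟨⟨A, h.disjoint, h.cover⟩, r, ⟨h.nonneg, fun i => ?_⟩, h.price_eq_zero, hr, hsat⟩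
    have h1 : |v i (A i)| ≤ ∑ S : Finset α, |v i S| :=
      Finset.single_le_sum (f := fun S => |v i S|) (fun S _ => abs_nonneg _) (Finset.mem_univ _)
    have := hsat i ∅
    simp only [Finset.biUnion_empty, hv, Finset.sum_empty] at this
    have h2 : min ε 1 ≤ 1 := min_le_right _ _
    show r i ≤ ∑ S : Finset α, |v i S| + 1
    linarith [le_abs_self (v i (A i))]
  obtain ⟨A, r, hrC, hR⟩ := isCompact_Icc.exists_forall_pos R hclosed hmono hex
  have hsat : ∀ i, ∀ T : Finset ι, v i (T.biUnion A.1) - ∑ k ∈ T, r k ≤ v i (A.1 i) - r i :=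
    fun i T => le_of_forall_pos_le_add fun ε hε =>
      ((hR ε hε).2.2 i T).trans (by gcongr; exact min_le_left _ _)
  exact ⟨A.1, r, ⟨A.2.1, A.2.2, hrC.1, (hR 1 one_pos).1, fun i _ T => by linarith [hsat i T]⟩,
    (hR 1 one_pos).2.1, hsat⟩

/-- Bundles that are owned by satisfied consumers form a competitive bundling equilibrium. -/
theorem IsMergingState.exists_equilibrium {v : ι → Finset α → ℝ} (hv : ∀ i, v i ∅ = 0)
    {A₀ : ι → Finset α} {r₀ : ι → ℝ} (h₀ : IsMergingState v 0 A₀ r₀) :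
    ∃ E : CompetitiveBundlingEquilibrium v, ∑ i, r₀ i ≤ E.revenue := by
  classical
  obtain ⟨A, r, h, hr, hsat⟩ := h₀.exists_exactly_satisfied hv
  have hinj : ∀ {i k}, A i ≠ ∅ → A i = A k → i = k := by
    intro i k hi hik
    by_contra hne
    have : Disjoint (A i) (A k) := h.disjoint hne
    rw [← hik, Finset.disjoint_self_iff_empty] at this
    exact hi this
  have hprice : ∀ {i}, A i ≠ ∅ → ∑ k with A k = A i, r k = r i := by
    intro i hi
    rw [Finset.sum_eq_single_of_mem i (by simp)]
    intro k hk hki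
    exact absurd (hinj hi (by simpa using (Finset.mem_filter.1 hk).2.symm)).symm hki
  have hsupIndep : (Finset.univ.image A).SupIndep id := by
    rw [Finset.supIndep_iff_pairwiseDisjoint]
    intro B hB C hC hBC
    simp only [Finset.coe_image, Finset.coe_univ, Set.image_univ, Set.mem_range] at hB hC
    obtain ⟨i, rfl⟩ := hB
    obtain ⟨k, rfl⟩ := hC
    exact h.disjoint fun hik => hBC (by rw [hik])
  have hsup : (Finset.univ.image A).sup id = Finset.univ := by
    rw [Finset.sup_image, ← h.cover, Finset.sup_eq_biUnion]
    rfl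
  let E : CompetitiveBundlingEquilibrium v :=
    { bundling := Finpartition.ofErase (Finset.univ.image A) hsupIndep hsup
      alloc := fun i => if A i = ∅ then ∅ else {A i}
      -- A non-empty bundle has a single owner, so the sum is that owner's price.
      price := fun B => ∑ k with A k = B, r k
      alloc_subset := by
        intro i
        split_ifs with hi
        · simp
        · simp [Finpartition.ofErase, hi]
      alloc_disjoint := by
        intro i k hik
        split_ifs with hi hk hk
        · simp
        · simp
        · simp
        · simp only [Finset.disjoint_singleton]
          exact fun heq => hik (hinj hi heq)
      price_nonneg := fun B _ => Finset.sum_nonneg fun k _ => h.nonneg k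
      profit_maximization := by
        intro i T hT
        have hown : v i ((if A i = ∅ then ∅ else {A i} : Finset (Finset α)).sup id) -
            ∑ B ∈ (if A i = ∅ then ∅ else {A i} : Finset (Finset α)), ∑ k with A k = B, r k
            = v i (A i) - r i := by
          split_ifs with hi
          · simp [hi, h.price_eq_zero i hi]
          · rw [Finset.sup_singleton, Finset.sum_singleton, hprice hi, id]
        have hset : T.sup id = (Finset.univ.filter fun k => A k ∈ T).biUnion A := by
          ext x
          simp only [Finset.mem_sup, id, Finset.mem_biUnion, Finset.mem_filter, Finset.mem_univ,
            true_and]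
          constructor
          · rintro ⟨B, hB, hx⟩
            have hB' := hT hB
            simp only [Finpartition.ofErase, Finset.mem_erase, Finset.mem_image, Finset.mem_univ,
              true_and] at hB'
            obtain ⟨-, k, rfl⟩ := hB'
            exact ⟨k, hB, hx⟩
          · rintro ⟨k, hk, hx⟩
            exact ⟨A k, hk, hx⟩
        have hsum : ∑ B ∈ T, ∑ k with A k = B, r k = ∑ k with A k ∈ T, r k := by
          rw [← Finset.sum_fiberwise_of_maps_to (g := A) (t := T) (fun k hk => by simpa using hk)]
          refine Finset.sum_congr rfl fun B hB => Finset.sum_congr ?_ fun _ _ => rfl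
          ext k
          simp only [Finset.mem_filter, Finset.mem_univ, true_and]
          exact ⟨fun hk => ⟨hk ▸ hB, hk⟩, fun hk => hk.2⟩
        rw [hown, hset, hsum]
        exact hsat i _
      market_clearance := by
        rw [Finset.eq_univ_iff_forall]
        intro x
        have hx : x ∈ Finset.univ.biUnion A := by simp [h.cover]
        obtain ⟨k, -, hk⟩ := Finset.mem_biUnion.1 hx
        rw [Finset.mem_sup]
        refine ⟨k, Finset.mem_univ k, ?_⟩
        rw [if_neg (Finset.ne_empty_of_mem hk), Finset.sup_singleton]
        exact hk }
  refine ⟨E, hr.trans_eq (Finset.sum_congr rfl fun i _ => ?_)⟩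
  show r i = ∑ B ∈ (if A i = ∅ then ∅ else {A i} : Finset (Finset α)), ∑ k with A k = B, r k
  split_ifs with hi
  · simp [h.price_eq_zero i hi]
  · rw [Finset.sum_singleton, hprice hi]

end MergingAuction

/-! ### From Walrasian equilibria to bundling equilibria with a surcharge -/

section WeightedRank

variable {ι α : Type*}

theorem IsWeightedRankFunction.empty {Q : Matroid α} {w : α → ℝ} {v : Finset α → ℝ}
    (h : IsWeightedRankFunction Q w v) : v ∅ = 0 := by
  obtain ⟨I, hI, -, hv⟩ := (h.2.2 ∅).1
  rw [hv, Finset.subset_empty.1 hI, Finset.sum_empty]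

theorem IsWeightedRankFunction.sum_le {Q : Matroid α} {w : α → ℝ} {v : Finset α → ℝ}
    (h : IsWeightedRankFunction Q w v) {A S : Finset α} (hA : Q.Indep (A : Set α)) (hAS : A ⊆ S) :
    ∑ e ∈ A, w e ≤ v S :=
  (h.2.2 S).2 ⟨A, hAS, hA, rfl⟩

/-- The value of `S` is attained on an independent subset, and the remaining items only cost money.
Hence optimality among independent sets is optimality among all sets. -/
theorem IsWeightedRankFunction.sub_le {Q : Matroid α} {w : α → ℝ} {v : Finset α → ℝ}
    (h : IsWeightedRankFunction Q w v) {p : α → ℝ} (hp : ∀ e, 0 ≤ p e) {A : Finset α}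
    (hA : Q.IsMaxWeightIndep (fun e => w e - p e) A) (S : Finset α) :
    v S - ∑ e ∈ S, p e ≤ ∑ e ∈ A, (w e - p e) := by
  obtain ⟨I, hIS, hI, hv⟩ := (h.2.2 S).1
  have h1 := hA.2 I hI
  have h2 := Finset.sum_le_sum_of_subset_of_nonneg hIS fun e _ _ => hp e
  rw [Finset.sum_sub_distrib] at h1
  linarith

variable [Fintype ι] [Fintype α] [DecidableEq α]

/-- A Walrasian equilibrium of the market restricted to the consumers in `K`, each of whom has
utility at least `ρ`, yields a competitive bundling equilibrium of the whole market whose revenue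
exceeds the total price of the items by `ρ` for every consumer in `K`. -/
theorem exists_equilibrium_of_walrasian {Q : ι → Matroid α} {w : ι → α → ℝ}
    {v : ι → Finset α → ℝ} (hv : ∀ i, IsWeightedRankFunction (Q i) (w i) (v i))
    {K : Finset ι} (hK : K.Nonempty) {A : ι → Finset α} {p : α → ℝ} {ρ : ℝ} (hρ : 0 ≤ ρ)
    (hdisj : Pairwise fun i k => Disjoint (A i) (A k)) (hp : ∀ e, 0 ≤ p e)
    (hAK : ∀ i ∉ K, A i = ∅)
    (hopt : ∀ i ∈ K, (Q i).IsMaxWeightIndep (fun e => w i e - p e) (A i))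
    (hu : ∀ i ∈ K, ρ ≤ ∑ e ∈ A i, (w i e - p e))
    (hunsold : ∀ e, (∀ i, e ∉ A i) → p e = 0) :
    ∃ E : CompetitiveBundlingEquilibrium v, ∑ e, p e + ρ * K.card ≤ E.revenue := by
  classical
  obtain ⟨i₀, hi₀⟩ := hK
  let U : Finset α := Finset.univ.filter fun e => ∀ i, e ∉ A i
  have hU : ∀ e, e ∈ U ↔ ∀ i, e ∉ A i := fun e => by simp [U]
  have hUA : ∀ i, Disjoint (A i) U := fun i =>
    Finset.disjoint_left.2 fun e he heU => (hU e).1 heU i he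
  -- Unsold items have price 0, so one consumer of `K` takes them for free to clear the market.
  let O : ι → Finset α := fun i => A i ∪ if i = i₀ then U else ∅
  have hAO : ∀ i, A i ⊆ O i := fun i => Finset.subset_union_left
  have hOK : ∀ i ∉ K, O i = ∅ := by
    intro i hi
    have : i ≠ i₀ := fun h => hi (h ▸ hi₀)
    simp [O, this, hAK i hi]
  have hpO : ∀ i, ∑ e ∈ O i, p e = ∑ e ∈ A i, p e := by
    intro i
    refine (Finset.sum_subset (hAO i) fun e he heA => hunsold e ?_).symm
    by_cases hi : i = i₀
    · exact (hU e).1 (by simpa [O, hi, heA, hi ▸ heA] using he)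
    · simp [O, hi, heA] at he
  have hOdisj : Pairwise fun i k => Disjoint (O i) (O k) := by
    intro i k hik
    have h1 : Disjoint (A i) (A k) := hdisj hik
    by_cases hi : i = i₀ <;> by_cases hk : k = i₀
    · exact absurd (hi.trans hk.symm) hik
    · simp [O, hi, hk, Finset.disjoint_union_left, (hUA k).symm, hi ▸ h1]
    · simp [O, hi, hk, Finset.disjoint_union_right, hUA i, hk ▸ h1]
    · simpa [O, hi, hk] using h1
  have hcover : Finset.univ.biUnion O = Finset.univ := by
    rw [Finset.eq_univ_iff_forall]
    intro e
    rw [Finset.mem_biUnion]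
    by_cases he : ∀ i, e ∉ A i
    · exact ⟨i₀, Finset.mem_univ _, by simp [O, (hU e).2 he]⟩
    · push Not at he
      obtain ⟨i, hi⟩ := he
      exact ⟨i, Finset.mem_univ _, hAO i hi⟩
  have hsum : ∀ T : Finset ι, ∑ i ∈ T, (∑ e ∈ O i, p e + if i ∈ K then ρ else 0) =
      ∑ e ∈ T.biUnion O, p e + ρ * (T ∩ K).card := by
    intro T
    rw [Finset.sum_add_distrib, Finset.sum_biUnion fun i _ k _ hik => hOdisj hik,
      ← Finset.sum_filter, Finset.sum_const, Finset.filter_mem_eq_inter, nsmul_eq_mul, mul_comm ρ]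
  -- Each consumer of `K` can afford the surcharge `ρ`. Deviating to nothing yields 0, and deviating
  -- to bundles owned in `K` costs at least one surcharge. Consumers outside `K` own nothing, so the
  -- state demands nothing of them.
  have hstate : IsMergingState v 0 O fun i => ∑ e ∈ O i, p e + if i ∈ K then ρ else 0 := by
    refine ⟨hOdisj, hcover, fun i => ?_, fun i hi => ?_, fun i hi T => ?_⟩
    · have := Finset.sum_nonneg fun e (_ : e ∈ O i) => hp e
      split_ifs <;> linarith
    · by_cases hiK : i ∈ K
      · have hAi : A i = ∅ := Finset.subset_empty.1 (hi ▸ hAO i)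
        have := hu i hiK
        simp only [hAi, Finset.sum_empty] at this
        simp [hi, hiK, le_antisymm this hρ]
      · simp [hi, hiK]
    · have hiK : i ∈ K := by
        by_contra hiK
        exact hi (hOK i hiK)
      have hown : ∑ e ∈ A i, (w i e - p e) ≤ v i (O i) - ∑ e ∈ O i, p e := by
        rw [hpO, Finset.sum_sub_distrib]
        linarith [(hv i).sum_le (hopt i hiK).1 (hAO i)]
      rw [hsum, if_pos hiK]
      rcases (T ∩ K).eq_empty_or_nonempty with hTK | hTK
      · have hT : T.biUnion O = ∅ := by
          rw [Finset.eq_empty_iff_forall_notMem]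
          intro x hx
          obtain ⟨k, hk, hxk⟩ := Finset.mem_biUnion.1 hx
          have hkK : k ∈ K := by
            by_contra hkK
            simp [hOK k hkK] at hxk
          have : k ∈ T ∩ K := Finset.mem_inter.2 ⟨hk, hkK⟩
          simp [hTK] at this
        simp only [hT, hTK, (hv i).empty, Finset.sum_empty, Finset.card_empty]
        have := hu i hiK
        simp
        linarith
      · have hcard : (1 : ℝ) ≤ (T ∩ K).card := by exact_mod_cast hTK.card_pos
        have h1 := (hv i).sub_le hp (hopt i hiK) (T.biUnion O)
        have h2 : ρ ≤ ρ * (T ∩ K).card := le_mul_of_one_le_right hρ hcard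
        linarith
  obtain ⟨E, hE⟩ := hstate.exists_equilibrium fun i => (hv i).empty
  refine ⟨E, le_trans (le_of_eq ?_) hE⟩
  rw [hsum, hcover, Finset.univ_inter]

end WeightedRank

/-! ### Harmonic bound on the utilities -/

/-- If at most `R / ρ` of the numbers `u i` are at least `ρ`, for every `ρ > 0`, then the sum of
positive ones among them is at most `R` times a harmonic number. -/
theorem sum_le_mul_harmonic {ι : Type*} [Fintype ι] {u : ι → ℝ} {R : ℝ}
    (hR : ∀ ρ > 0, ρ * (Finset.univ.filter fun i => ρ ≤ u i).card ≤ R) (X : Finset ι)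
    (hX : ∀ i ∈ X, 0 < u i) : ∑ i ∈ X, u i ≤ R * (harmonic X.card : ℝ) := by
  classical
  induction hn : X.card generalizing X with
  | zero => simp [Finset.card_eq_zero.1 hn]
  | succ n ih =>
    have hne : X.Nonempty := Finset.card_pos.1 (by omega)
    -- All `n + 1` numbers reach the smallest one, which is therefore at most `R / (n + 1)`; remove
    -- it and induct.
    obtain ⟨i, hi, hmin⟩ := X.exists_min_image u hne
    have h1 := ih (X.erase i) (fun k hk => hX k (Finset.mem_of_mem_erase hk))
      (by rw [Finset.card_erase_of_mem hi]; omega)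
    have h2 : u i * ((n + 1 : ℕ) : ℝ) ≤ R := by
      refine le_trans ?_ (hR (u i) (hX i hi))
      gcongr
      · exact (hX i hi).le
      · rw [← hn]
        exact Finset.card_le_card fun k hk => by simpa using hmin k hk
    have h3 : u i ≤ R * (((n + 1 : ℕ) : ℝ))⁻¹ := by
      rw [← div_eq_mul_inv, le_div_iff₀ (by positivity)]
      exact h2
    rw [← Finset.add_sum_erase _ _ hi, harmonic_succ]
    push_cast at h3 ⊢
    linarith

/-! ### Welfare against revenue -/

section Revenue

variable {ι α : Type*} [Fintype ι] [Fintype α] [DecidableEq α]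

/-- Weak duality: disjoint sets cost at most the total price, and value beyond cost is bounded by
the utilities. -/
theorem optimalWelfare_le_of_prices {v : ι → Finset α → ℝ} {p : α → ℝ} (hp : ∀ e, 0 ≤ p e)
    {u : ι → ℝ} (h : ∀ i S, v i S - ∑ e ∈ S, p e ≤ u i) :
    optimalWelfare v ≤ ∑ e, p e + ∑ i, u i := by
  have : Nonempty {O : ι → Finset α // Pairwise fun i k => Disjoint (O i) (O k)} :=
    ⟨⟨fun _ => ∅, fun _ _ _ => Finset.disjoint_empty_left _⟩⟩
  refine ciSup_le fun O => ?_
  have h1 : ∑ i, ∑ e ∈ O.1 i, p e ≤ ∑ e, p e := by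
    rw [← Finset.sum_biUnion fun i _ k _ hik => O.2 hik]
    exact Finset.sum_le_sum_of_subset_of_nonneg (Finset.subset_univ _) fun e _ _ => hp e
  have h2 : ∑ i, (v i (O.1 i) - ∑ e ∈ O.1 i, p e) ≤ ∑ i, u i :=
    Finset.sum_le_sum fun i _ => h i _
  rw [Finset.sum_sub_distrib] at h2
  linarith

/-- For weighted rank functions of arbitrary matroids, some competitive bundling equilibrium
extracts a logarithmic fraction of the optimal welfare. -/
theorem exists_equilibrium_revenue_ge [Nonempty ι] {Q : ι → Matroid α} {w : ι → α → ℝ}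
    {v : ι → Finset α → ℝ} (hv : ∀ i, IsWeightedRankFunction (Q i) (w i) (v i)) :
    ∃ E : CompetitiveBundlingEquilibrium v,
      1 / 2 / (1 + Real.log (min (Fintype.card ι) (Fintype.card α) : ℕ)) * optimalWelfare v
        ≤ E.revenue := by
  classical
  -- At starting prices `∑ i, w i e` no item is worth buying, so empty sets are optimal.
  obtain ⟨A, p, hdisj, hp, -, hopt, hunsold⟩ := exists_walrasian_le Q w
    (p₀ := fun e => ∑ i, w i e) (S := fun _ => ∅)
    (fun e => Finset.sum_nonneg fun i _ => (hv i).2.1 e)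
    (fun _ _ _ => Finset.disjoint_empty_left _)
    (fun i => ⟨by simp, fun I _ => by
      rw [Finset.sum_empty]
      refine Finset.sum_nonpos fun e _ => sub_nonpos.2 ?_
      exact Finset.single_le_sum (f := fun i => w i e) (fun k _ => (hv k).2.1 e)
        (Finset.mem_univ i)⟩)
  set u : ι → ℝ := fun i => ∑ e ∈ A i, (w i e - p e) with hu
  have hu0 : ∀ i, 0 ≤ u i := fun i => by
    have := (hopt i).2 ∅ (by simp)
    rwa [Finset.sum_empty] at this
  set μ := min (Fintype.card ι) (Fintype.card α) with hμ
  have hlog : 0 ≤ Real.log (μ : ℝ) := Real.log_natCast_nonneg μ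
  by_contra! hcon
  set B := 1 / 2 / (1 + Real.log (μ : ℝ)) * optimalWelfare v with hB
  have hpB : ∑ e, p e < B := by
    obtain ⟨E, hE⟩ := exists_equilibrium_of_walrasian hv Finset.univ_nonempty le_rfl hdisj hp
      (by simp) (fun i _ => hopt i) (fun i _ => hu0 i) hunsold
    rw [zero_mul, add_zero] at hE
    exact hE.trans_lt (hcon E)
  have hB0 : 0 < B := (Finset.sum_nonneg fun e _ => hp e).trans_lt hpB
  have hmany : ∀ ρ > 0, ρ * (Finset.univ.filter fun i => ρ ≤ u i).card ≤ B := by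
    intro ρ hρ
    set K := Finset.univ.filter fun i => ρ ≤ u i with hKdef
    have hmemK : ∀ i, i ∈ K ↔ ρ ≤ u i := fun i => by simp [K]
    rcases K.eq_empty_or_nonempty with hK | hK
    · simp [hK, hB0.le]
    -- Discarding consumers outside `K` may leave items unsold at positive prices. Descending from
    -- `p` repairs this, and lower prices keep utilities at least `ρ`.
    · obtain ⟨A', p', hdisj', hp', hpp', hopt', hunsold'⟩ := exists_walrasian_le
        (ι := K) (fun i => Q i) (fun i => w i) (p₀ := p) (S := fun i => A i) hp
        (fun i k hik => hdisj fun h => hik (Subtype.ext h)) (fun i => hopt i)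
      let C : ι → Finset α := fun i => if h : i ∈ K then A' ⟨i, h⟩ else ∅
      have hC : ∀ i (h : i ∈ K), C i = A' ⟨i, h⟩ := fun i h => by simp [C, h]
      have hC' : ∀ i ∉ K, C i = ∅ := fun i h => by simp [C, h]
      have hCdisj : Pairwise fun i k => Disjoint (C i) (C k) := by
        intro i k hik
        by_cases hi : i ∈ K
        · by_cases hk : k ∈ K
          · rw [hC i hi, hC k hk]
            exact hdisj' fun h => hik (congrArg Subtype.val h)
          · simp [hC' k hk]
        · simp [hC' i hi]
      have hCu : ∀ i ∈ K, ρ ≤ ∑ e ∈ C i, (w i e - p' e) := by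
        intro i hi
        rw [hC i hi]
        refine ((hmemK i).1 hi).trans (le_trans ?_ ((hopt' ⟨i, hi⟩).2 (A i) (hopt i).1))
        exact Finset.sum_le_sum fun e _ => sub_le_sub_left (hpp' e) _
      obtain ⟨E, hE⟩ := exists_equilibrium_of_walrasian hv hK hρ.le hCdisj hp' hC'
        (fun i hi => by rw [hC i hi]; exact hopt' ⟨i, hi⟩) hCu
        (fun e he => hunsold' e fun i => by simpa [hC i.1 i.2] using he i.1)
      have := Finset.sum_nonneg fun e (_ : e ∈ Finset.univ) => hp' e
      linarith [hcon E]
  -- Positive utility needs a non-empty set, and these sets are disjoint.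
  have hcard : (Finset.univ.filter fun i => 0 < u i).card ≤ μ := by
    refine le_min (Finset.card_le_univ _) ?_
    have hne : ∀ i ∈ Finset.univ.filter fun i => 0 < u i, (A i).Nonempty := by
      intro i hi
      rw [Finset.nonempty_iff_ne_empty]
      intro hAi
      simp [hu, hAi] at hi
    calc (Finset.univ.filter fun i => 0 < u i).card
        ≤ ((Finset.univ.filter fun i => 0 < u i).biUnion A).card :=
          Finset.card_le_card_biUnion (fun i _ k _ hik => hdisj hik) hne
      _ ≤ Fintype.card α := Finset.card_le_univ _
  have hsumu : ∑ i, u i ≤ B * (1 + Real.log (μ : ℝ)) := by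
    have h1 := sum_le_mul_harmonic hmany (Finset.univ.filter fun i => 0 < u i) (by simp)
    have h2 : ∑ i with 0 < u i, u i = ∑ i, u i := by
      refine Finset.sum_filter_of_ne fun i _ hi => lt_of_le_of_ne (hu0 i) hi.symm
    rw [h2] at h1
    refine h1.trans (mul_le_mul_of_nonneg_left ?_ hB0.le)
    refine le_trans ?_ (harmonic_le_one_add_log μ)
    have : harmonic (Finset.univ.filter fun i => 0 < u i).card ≤ harmonic μ := by
      unfold harmonic
      exact Finset.sum_le_sum_of_subset_of_nonneg (Finset.range_mono hcard)
        fun i _ _ => by positivity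
    exact_mod_cast this
  have hopt_le : optimalWelfare v ≤ ∑ e, p e + ∑ i, u i :=
    optimalWelfare_le_of_prices hp fun i S => (hv i).sub_le hp (hopt i) S
  have hBeq : B * (1 + Real.log (μ : ℝ)) = optimalWelfare v / 2 := by
    rw [hB]
    field_simp
  -- OPT is less than `B + B * (1 + log μ)`, hence than `2 * B * (1 + log μ)`, which equals OPT by
  -- the choice of the constant 1/2: a contradiction.
  have : B ≤ B * (1 + Real.log (μ : ℝ)) := le_mul_of_one_le_right hB0.le (by linarith)
  linarith

end Revenue

theorem mainTheorem8 :
    ∃ c : ℝ, 0 < c ∧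
      ∀ (n m : ℕ), 0 < n →
        ∀ v : Fin n → Finset (Fin m) → ℝ,
          (AllUniformRank v ∨ AllCommonMatroidRank v) →
            ∃ E : CompetitiveBundlingEquilibrium v,
              c / (1 + Real.log (min n m : ℕ)) * optimalWelfare v ≤ E.revenue := by
  refine ⟨1 / 2, by norm_num, fun n m hn v hv => ?_⟩
  have : Nonempty (Fin n) := ⟨⟨0, hn⟩⟩
  have hrank : ∃ (Q : Fin n → Matroid (Fin m)) (w : Fin n → Fin m → ℝ),
      ∀ i, IsWeightedRankFunction (Q i) (w i) (v i) := by
    rcases hv with hv | ⟨Q, hv⟩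
    · choose k w hw using hv
      exact ⟨fun i => uniformMatroid (Fin m) (k i), w, hw⟩
    · choose w hw using hv
      exact ⟨fun _ => Q, w, hw⟩
  obtain ⟨Q, w, hw⟩ := hrank
  simpa using exists_equilibrium_revenue_ge hw
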